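/- For $\lambda>0$ let $C_n^{\lambda}$ be the Gegenbauer polynomials, given by $C_0^\lambda(x)=1$, $C_1^\lambda(x)=2\lambda x$ and $C_n^\lambda(x)=\frac{n+\lambda-1}{n}\,2x\,C_{n-1}^\lambda(x)-\frac{n+2\lambda-2}{n}\,C_{n-2}^\lambda(x)$ for $n\ge 2$. A number $x\in(-1,1)$ is called $\lambda$-gegenbadly approximable if there is a constant $c_x>0$ such that $|C_n^\lambda(x)|\ge c_x\, n^{\lambda-1}$ for all integers $n\ge 1$. For $y\in\mathbb R$ let $\|y\|=\min_{m\in\mathbb Z}|y-m|$ be the distance to the nearest integer; a real number is divisible by $2q$ if it is an integer multiple of $2q$. Theorem. Suppose that $\lambda>0$ is not an odd integer and let $x\in(-1,1)$. If $x$ is $\lambda$-gegenbadly approximable, then there are integers $p,q$ with $0<p<q$ such that (i) $x=\cos(\pi p/q)$, and (ii) for all integers $1\le n\le q$, the number $\lambda(2p-q)+2np-q$ is not divisible by $2q$. Conversely, if $x$ satisfies (i) and (ii) for integers $0<p<q$, then there is an integer $N_{x,\lambda}\ge 0$ such that either there exists $0\le n\le N_{x,\lambda}$ with $C_n^\lambda(x)=0$,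 or $x$ is $\lambda$-gegenbadly approximable; moreover, $$N_{x,\lambda}\le\frac{\pi}{2}\,\frac{\lambda|1-\lambda|\cdot|\cot(\pi p/q)|}{\min_{1\le n\le q}\left\|(n+\lambda)\frac pq-\frac{\lambda+1}{2}\right\|}.$$ -/

import Mathlib

/-- The Gegenbauer polynomials `C_n^lam`, as functions on `ℝ`, through the three-term recursion
`C_0 = 1`, `C_1 = 2 lam x`,
`C_n = (n + lam - 1) / n * 2 x * C_{n-1} - (n + 2 lam - 2) / n * C_{n-2}` for `n ≥ 2`
(written here with `n + 2` in place of `n`). -/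
noncomputable def gegenbauer (lam : ℝ) : ℕ → ℝ → ℝ
  | 0, _ => 1
  | 1, x => 2 * lam * x
  | n + 2, x =>
      (((n : ℝ) + 2) + lam - 1) / ((n : ℝ) + 2) * (2 * x) * gegenbauer lam (n + 1) x
        - (((n : ℝ) + 2) + 2 * lam - 2) / ((n : ℝ) + 2) * gegenbauer lam n x

/-- `x ∈ (-1, 1)` is gegenbadly approximable with respect to `lam`: there is `c > 0` with
`|C_n^lam (x)| ≥ c * n ^ (lam - 1)` for all positive integers `n`. -/
def IsGegenbadlyApproximable (lam x : ℝ) : Prop :=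
  x ∈ Set.Ioo (-1 : ℝ) 1 ∧
    ∃ c : ℝ, 0 < c ∧ ∀ n : ℕ, 1 ≤ n → c * (n : ℝ) ^ (lam - 1) ≤ |gegenbauer lam n x|

/-- The distance from a real number to the nearest integer. -/
noncomputable def distNearestInt (y : ℝ) : ℝ := |y - (round y : ℝ)|

theorem distNearestInt_isLeast (y : ℝ) :
    IsLeast (Set.range fun m : ℤ => |y - (m : ℝ)|) (distNearestInt y) := by
  refine ⟨⟨round y, rfl⟩, ?_⟩
  rintro _ ⟨m, rfl⟩
  exact round_le y m

/-- A real number `y` is divisible by the integer `d`: it is an integer multiple of `d`. -/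
def RealDivisibleBy (d : ℤ) (y : ℝ) : Prop := ∃ m : ℤ, y = (d : ℝ) * (m : ℝ)

/-- `x = cos (π p / q)`, where the angle `π p / q` lies in `(0, π)`. -/
def IsCosOfRationalAngle (x : ℝ) (p q : ℕ) : Prop :=
  0 < p ∧ p < q ∧ x = Real.cos (Real.pi * ((p : ℝ) / (q : ℝ)))

/-- `lam * (2 p - q) + 2 n p - q` is not divisible by `2 q`, for every `1 ≤ n ≤ q`. -/
def NonDivisibilityCondition (lam : ℝ) (p q : ℕ) : Prop :=
  ∀ n : ℕ, 1 ≤ n → n ≤ q →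
    ¬ RealDivisibleBy (2 * (q : ℤ))
        (lam * (2 * (p : ℝ) - (q : ℝ)) + 2 * (n : ℝ) * (p : ℝ) - (q : ℝ))

/-- The minimum over `1 ≤ n ≤ q` of the distance from `(n + lam) p / q - (lam + 1) / 2` to the
nearest integer. -/
noncomputable def minPhaseDist (lam : ℝ) (p q : ℕ) : ℝ :=
  sInf ((fun n : ℕ => distNearestInt (((n : ℝ) + lam) * ((p : ℝ) / (q : ℝ)) - (lam + 1) / 2)) ''
    Set.Icc 1 q)

theorem minPhaseDist_isLeast (lam : ℝ) (p q : ℕ) (hq : 1 ≤ q) :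
    IsLeast ((fun n : ℕ =>
      distNearestInt (((n : ℝ) + lam) * ((p : ℝ) / (q : ℝ)) - (lam + 1) / 2)) '' Set.Icc 1 q)
      (minPhaseDist lam p q) := by
  have hfin := (Set.finite_Icc 1 q).image (fun n : ℕ =>
      distNearestInt (((n : ℝ) + lam) * ((p : ℝ) / (q : ℝ)) - (lam + 1) / 2))
  have hne : (Set.Icc 1 q).Nonempty := ⟨1, le_refl 1, hq⟩
  exact ⟨(hne.image _).csInf_mem hfin, fun y hy => csInf_le hfin.bddBelow hy⟩

/-! The function `u = sin θ ^ lam * C_n (cos θ)` is a harmonic oscillator of frequency `n + lam`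
perturbed by the potential `lam (1 - lam) / sin θ ^ 2`. Matching data at `π / 2` with the pure
oscillator, variation of constants gives a relative error `O(1 / n)` with explicit constant `lam |1
- lam| |cot θ|` (`abs_weightedGegenbauer_sub_le_amplitude`). By parity of `C_n`, the oscillator is,
up to sign, `A_n cos ((n + lam) θ - lam π / 2)`, and `A_n` has exact order `n ^ (lam - 1)`.

So a lower bound of order `n ^ (lam - 1)` for large `n` means that these cosines stay away from `0`.
With `θ = π α` and `α` irrational, the phases are dense modulo `π` and this fails. With `α = p / q`
they are periodic in `n`, and divisibility by `2 q` says exactly that one of the cosines vanishes.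
Otherwise they are uniformly bounded below, and the explicit error constant gives the threshold
beyond which `C_n` cannot vanish. -/

/-! ### Recurrences and derivatives of Gegenbauer polynomials. -/

theorem gegenbauer_zero (lam x : ℝ) : gegenbauer lam 0 x = 1 := by rw [gegenbauer]

theorem gegenbauer_one (lam x : ℝ) : gegenbauer lam 1 x = 2 * lam * x := by rw [gegenbauer]

theorem gegenbauer_add_two (lam : ℝ) (n : ℕ) (x : ℝ) :
    ((n : ℝ) + 2) * gegenbauer lam (n + 2) x
      = 2 * (n + 1 + lam) * x * gegenbauer lam (n + 1) x - (n + 2 * lam) * gegenbauer lam n x := by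
  rw [gegenbauer]
  have : (n : ℝ) + 2 ≠ 0 := by positivity
  field_simp
  ring

theorem differentiable_gegenbauer (lam : ℝ) (n : ℕ) : Differentiable ℝ (gegenbauer lam n) := by
  induction n using Nat.twoStepInduction with
  | zero =>
    have : gegenbauer lam 0 = fun _ => 1 := funext (gegenbauer_zero lam)
    rw [this]; fun_prop
  | one =>
    have : gegenbauer lam 1 = fun x => 2 * lam * x := funext (gegenbauer_one lam)
    rw [this]; fun_prop
  | more n h0 h1 =>
    have : gegenbauer lam (n + 2) = fun x =>
        (((n : ℝ) + 2) + lam - 1) / ((n : ℝ) + 2) * (2 * x) * gegenbauer lam (n + 1) x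
          - (((n : ℝ) + 2) + 2 * lam - 2) / ((n : ℝ) + 2) * gegenbauer lam n x := by
      funext x; rw [gegenbauer]
    rw [this]; fun_prop

theorem hasDerivAt_gegenbauer (lam : ℝ) (n : ℕ) (x : ℝ) :
    HasDerivAt (gegenbauer lam n) (deriv (gegenbauer lam n) x) x :=
  (differentiable_gegenbauer lam n x).hasDerivAt

theorem deriv_gegenbauer_add_two (lam : ℝ) (n : ℕ) (x : ℝ) :
    ((n : ℝ) + 2) * deriv (gegenbauer lam (n + 2)) x
      = 2 * (n + 1 + lam) * (gegenbauer lam (n + 1) x + x * deriv (gegenbauer lam (n + 1)) x)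
        - (n + 2 * lam) * deriv (gegenbauer lam n) x := by
  have h := (hasDerivAt_gegenbauer lam (n + 2) x).const_mul ((n : ℝ) + 2)
  have h' := (((hasDerivAt_id x).const_mul (2 * ((n : ℝ) + 1 + lam))).mul
    (hasDerivAt_gegenbauer lam (n + 1) x)).sub
    ((hasDerivAt_gegenbauer lam n x).const_mul ((n : ℝ) + 2 * lam))
  have e : (fun y => ((n : ℝ) + 2) * gegenbauer lam (n + 2) y)
      = (fun y => 2 * ((n : ℝ) + 1 + lam) * id y) * gegenbauer lam (n + 1)
        - fun y => ((n : ℝ) + 2 * lam) * gegenbauer lam n y := by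
    funext y
    exact gegenbauer_add_two lam n y
  rw [e] at h
  rw [h.unique h']
  simp
  ring

/-- The two relations are proved together because the inductive step for each uses the other. -/
theorem deriv_gegenbauer_succ (lam : ℝ) (n : ℕ) (x : ℝ) :
    deriv (gegenbauer lam (n + 1)) x
        = x * deriv (gegenbauer lam n) x + (n + 2 * lam) * gegenbauer lam n x ∧
      x * deriv (gegenbauer lam (n + 1)) x - deriv (gegenbauer lam n) x
        = (n + 1) * gegenbauer lam (n + 1) x := by
  induction n with
  | zero =>
    have h0 : gegenbauer lam 0 = fun _ => 1 := funext (gegenbauer_zero lam)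
    have h1 : gegenbauer lam 1 = fun x => 2 * lam * x := funext (gegenbauer_one lam)
    have hd : deriv (fun x : ℝ => 2 * lam * x) x = 2 * lam := by
      simp
    simp only [zero_add, h0, h1, hd, deriv_const]
    constructor
    · simp
    · simp; ring
  | succ n ih =>
    obtain ⟨hP, hQ⟩ := ih
    have hr := gegenbauer_add_two lam n x
    have hd := deriv_gegenbauer_add_two lam n x
    have hn : (n : ℝ) + 2 ≠ 0 := by positivity
    have hP' : deriv (gegenbauer lam (n + 2)) x = x * deriv (gegenbauer lam (n + 1)) x
        + (n + 1 + 2 * lam) * gegenbauer lam (n + 1) x := by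
      apply mul_left_cancel₀ hn
      linear_combination hd + ((n : ℝ) + 2 * lam) * hQ
    refine ⟨by push_cast; exact hP', ?_⟩
    push_cast
    rw [show n + 1 + 1 = n + 2 from rfl, hP']
    linear_combination x * hQ - hP - hr

theorem one_sub_sq_mul_deriv_gegenbauer (lam : ℝ) (n : ℕ) (x : ℝ) :
    (1 - x ^ 2) * deriv (gegenbauer lam n) x
      = (n + 2 * lam) * x * gegenbauer lam n x - (n + 1) * gegenbauer lam (n + 1) x := by
  obtain ⟨hP, hQ⟩ := deriv_gegenbauer_succ lam n x
  linear_combination x * hP - hQ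

theorem one_sub_sq_mul_deriv_gegenbauer_succ (lam : ℝ) (n : ℕ) (x : ℝ) :
    (1 - x ^ 2) * deriv (gegenbauer lam (n + 1)) x
      = (n + 2 * lam) * gegenbauer lam n x - (n + 1) * x * gegenbauer lam (n + 1) x := by
  obtain ⟨hP, hQ⟩ := deriv_gegenbauer_succ lam n x
  linear_combination hP - x * hQ

/-! ### The differential equation in the angle. -/

/-- `sin θ ^ lam * C_n^lam (cos θ)`, a solution of
`u'' + ((n + lam) ^ 2 + lam (1 - lam) / sin θ ^ 2) u = 0`. -/
noncomputable def weightedGegenbauer (lam : ℝ) (n : ℕ) (t : ℝ) : ℝ :=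
  Real.sin t ^ lam * gegenbauer lam n (Real.cos t)

/-- The derivative of `weightedGegenbauer`. -/
noncomputable def weightedGegenbauerDeriv (lam : ℝ) (n : ℕ) (t : ℝ) : ℝ :=
  Real.sin t ^ lam * (((n + 1) * gegenbauer lam (n + 1) (Real.cos t)
    - (n + lam) * (Real.cos t * gegenbauer lam n (Real.cos t))) / Real.sin t)

theorem hasDerivAt_sin_rpow (lam : ℝ) {t : ℝ} (ht : 0 < Real.sin t) :
    HasDerivAt (fun t => Real.sin t ^ lam) (Real.sin t ^ lam * (lam * Real.cos t / Real.sin t))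
      t := by
  convert (Real.hasDerivAt_sin t).rpow_const (p := lam) (Or.inl ht.ne') using 1
  rw [Real.rpow_sub_one ht.ne']
  field_simp

theorem hasDerivAt_gegenbauer_cos (lam : ℝ) (n : ℕ) {t : ℝ} (ht : 0 < Real.sin t) :
    HasDerivAt (fun t => gegenbauer lam n (Real.cos t))
      (((n + 1) * gegenbauer lam (n + 1) (Real.cos t)
        - (n + 2 * lam) * Real.cos t * gegenbauer lam n (Real.cos t)) / Real.sin t) t := by
  refine ((hasDerivAt_gegenbauer lam n (Real.cos t)).comp t (Real.hasDerivAt_cos t)).congr_deriv ?_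
  have h := one_sub_sq_mul_deriv_gegenbauer lam n (Real.cos t)
  rw [← Real.sin_sq] at h
  field_simp
  linear_combination -h

theorem hasDerivAt_gegenbauer_succ_cos (lam : ℝ) (n : ℕ) {t : ℝ} (ht : 0 < Real.sin t) :
    HasDerivAt (fun t => gegenbauer lam (n + 1) (Real.cos t))
      (((n + 1) * Real.cos t * gegenbauer lam (n + 1) (Real.cos t)
        - (n + 2 * lam) * gegenbauer lam n (Real.cos t)) / Real.sin t) t := by
  refine ((hasDerivAt_gegenbauer lam (n + 1) (Real.cos t)).comp t
    (Real.hasDerivAt_cos t)).congr_deriv ?_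
  have h := one_sub_sq_mul_deriv_gegenbauer_succ lam n (Real.cos t)
  rw [← Real.sin_sq] at h
  field_simp
  linear_combination -h

theorem hasDerivAt_weightedGegenbauer (lam : ℝ) (n : ℕ) {t : ℝ} (ht : 0 < Real.sin t) :
    HasDerivAt (weightedGegenbauer lam n) (weightedGegenbauerDeriv lam n t) t := by
  refine ((hasDerivAt_sin_rpow lam ht).mul (hasDerivAt_gegenbauer_cos lam n ht)).congr_deriv ?_
  rw [weightedGegenbauerDeriv]
  field_simp
  ring

theorem hasDerivAt_weightedGegenbauerDeriv (lam : ℝ) (n : ℕ) {t : ℝ} (ht : 0 < Real.sin t) :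
    HasDerivAt (weightedGegenbauerDeriv lam n)
      (-(((n : ℝ) + lam) ^ 2 + lam * (1 - lam) / Real.sin t ^ 2) * weightedGegenbauer lam n t)
      t := by
  refine ((hasDerivAt_sin_rpow lam ht).mul
    ((((hasDerivAt_gegenbauer_succ_cos lam n ht).const_mul ((n : ℝ) + 1)).sub
      (((Real.hasDerivAt_cos t).mul (hasDerivAt_gegenbauer_cos lam n ht)).const_mul
        ((n : ℝ) + lam))).div (Real.hasDerivAt_sin t) ht.ne')).congr_deriv ?_
  rw [weightedGegenbauer]
  simp only [Pi.mul_apply, Pi.sub_apply, Pi.div_apply]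
  field_simp
  linear_combination ((n : ℝ) + lam) * (n + lam + 1) * gegenbauer lam n (Real.cos t) *
    Real.sin_sq_add_cos_sq t

/-! ### Comparison with the harmonic oscillator. -/

/-- Both `g - f` and `g + f` are monotone; this replaces integration in the variation of constants.
-/
theorem abs_sub_le_abs_sub_of_abs_deriv_le {f g f' g' : ℝ → ℝ} {a b : ℝ}
    (hf : ∀ t ∈ Set.uIcc a b, HasDerivAt f (f' t) t)
    (hg : ∀ t ∈ Set.uIcc a b, HasDerivAt g (g' t) t)
    (h : ∀ t ∈ Set.uIcc a b, |f' t| ≤ g' t) : |f b - f a| ≤ |g b - g a| := by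
  wlog hab : a ≤ b generalizing a b
  · rw [abs_sub_comm, abs_sub_comm (g b)]
    rw [Set.uIcc_comm] at hf hg h
    exact this hf hg h (le_of_not_ge hab)
  rw [Set.uIcc_of_le hab] at hf hg h
  have hsub : interior (Set.Icc a b) ⊆ Set.Icc a b := interior_subset
  have hm : MonotoneOn (fun t => g t - f t) (Set.Icc a b) := by
    apply monotoneOn_of_deriv_nonneg (convex_Icc a b)
    · exact fun t ht => ((hg t ht).sub (hf t ht)).continuousAt.continuousWithinAt
    · exact fun t ht => ((hg t (hsub ht)).sub (hf t (hsub ht)))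
        |>.differentiableAt.differentiableWithinAt
    · intro t ht
      rw [HasDerivAt.deriv (f := fun t => g t - f t) ((hg t (hsub ht)).sub (hf t (hsub ht)))]
      linarith [le_abs_self (f' t), h t (hsub ht)]
  have hp : MonotoneOn (fun t => g t + f t) (Set.Icc a b) := by
    apply monotoneOn_of_deriv_nonneg (convex_Icc a b)
    · exact fun t ht => ((hg t ht).add (hf t ht)).continuousAt.continuousWithinAt
    · exact fun t ht => ((hg t (hsub ht)).add (hf t (hsub ht)))
        |>.differentiableAt.differentiableWithinAt
    · intro t ht
      rw [HasDerivAt.deriv (f := fun t => g t + f t) ((hg t (hsub ht)).add (hf t (hsub ht)))]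
      linarith [neg_abs_le (f' t), h t (hsub ht)]
  have h1 := hm (Set.left_mem_Icc.2 hab) (Set.right_mem_Icc.2 hab) hab
  have h2 := hp (Set.left_mem_Icc.2 hab) (Set.right_mem_Icc.2 hab) hab
  simp only at h1 h2
  refine le_trans ?_ (le_abs_self _)
  rw [abs_le]
  constructor <;> linarith

/-- The solution of `u'' + (n + lam) ^ 2 u = 0` with the same initial values at `π / 2` as
`weightedGegenbauer lam n`. -/
noncomputable def harmonicGegenbauer (lam : ℝ) (n : ℕ) (t : ℝ) : ℝ :=
  gegenbauer lam n 0 * Real.cos ((n + lam) * (t - Real.pi / 2))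
    + (n + 1) * gegenbauer lam (n + 1) 0 / (n + lam) * Real.sin ((n + lam) * (t - Real.pi / 2))

/-- The amplitude of `harmonicGegenbauer lam n`. -/
noncomputable def gegenbauerAmplitude (lam : ℝ) (n : ℕ) : ℝ :=
  |gegenbauer lam n 0| + (n + 1) * |gegenbauer lam (n + 1) 0| / (n + lam)

theorem sin_pos_of_mem_uIcc {θ t : ℝ} (hθ : θ ∈ Set.Ioo 0 Real.pi)
    (ht : t ∈ Set.uIcc (Real.pi / 2) θ) : 0 < Real.sin t := by
  have hπ := Real.pi_pos
  have h2 : Real.pi / 2 ∈ Set.Ioo 0 Real.pi := ⟨by linarith, by linarith⟩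
  have := Set.ordConnected_Ioo.uIcc_subset h2 hθ ht
  exact Real.sin_pos_of_mem_Ioo this

theorem abs_weightedGegenbauer_sub_le {lam : ℝ} (hlam : 0 < lam) (n : ℕ) {θ M : ℝ}
    (hθ : θ ∈ Set.Ioo 0 Real.pi)
    (hM : ∀ t ∈ Set.uIcc (Real.pi / 2) θ, |weightedGegenbauer lam n t| ≤ M) :
    |weightedGegenbauer lam n θ - harmonicGegenbauer lam n θ|
      ≤ lam * |1 - lam| / (n + lam) * M * |Real.cos θ / Real.sin θ| := by
  have hν : (0 : ℝ) < n + lam := by positivity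
  set ν : ℝ := n + lam with hνdef
  have hM0 : 0 ≤ M := (abs_nonneg _).trans (hM θ Set.right_mem_uIcc)
  have hsin := fun t ht => sin_pos_of_mem_uIcc (t := t) hθ ht
  -- This function interpolates between the oscillator at `θ` (for `t = π / 2`) and `u θ` (for `t =
  -- θ`); its derivative contains only the perturbing potential.
  have hE : ∀ t ∈ Set.uIcc (Real.pi / 2) θ, HasDerivAt
      (fun t => weightedGegenbauer lam n t * Real.cos (ν * (θ - t))
        + weightedGegenbauerDeriv lam n t * Real.sin (ν * (θ - t)) / ν)
      (-(lam * (1 - lam) / Real.sin t ^ 2 * weightedGegenbauer lam n t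
        * Real.sin (ν * (θ - t)) / ν)) t := by
    intro t ht
    have hlin : HasDerivAt (fun t => ν * (θ - t)) (-ν) t := by
      simpa using ((hasDerivAt_id t).const_sub θ).const_mul ν
    refine (((hasDerivAt_weightedGegenbauer lam n (hsin t ht)).mul hlin.cos).add
      (((hasDerivAt_weightedGegenbauerDeriv lam n (hsin t ht)).mul hlin.sin).div_const ν)
      ).congr_deriv ?_
    rw [← hνdef]
    have := (hsin t ht).ne'
    field_simp
    ring
  -- The primitive `-cot` of `1 / sin ^ 2` vanishes at `π / 2`, so only `cot θ` survives.
  have hC : ∀ t ∈ Set.uIcc (Real.pi / 2) θ, HasDerivAt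
      (fun t => lam * |1 - lam| / ν * M * -(Real.cos t / Real.sin t))
      (lam * |1 - lam| / ν * M * (1 / Real.sin t ^ 2)) t := by
    intro t ht
    have hs := (hsin t ht).ne'
    refine (((Real.hasDerivAt_cos t).div (Real.hasDerivAt_sin t) hs).neg.const_mul
      (lam * |1 - lam| / ν * M)).congr_deriv ?_
    congr 1
    field_simp
    linear_combination Real.sin_sq_add_cos_sq t
  have key := abs_sub_le_abs_sub_of_abs_deriv_le hE hC ?_
  · simp only [sub_self, mul_zero, Real.cos_zero, Real.sin_zero, Real.cos_pi_div_two, zero_div,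
      neg_zero, mul_one, add_zero, sub_zero] at key
    have e : weightedGegenbauer lam n (Real.pi / 2) * Real.cos (ν * (θ - Real.pi / 2))
        + weightedGegenbauerDeriv lam n (Real.pi / 2) * Real.sin (ν * (θ - Real.pi / 2)) / ν
        = harmonicGegenbauer lam n θ := by
      simp only [weightedGegenbauer, weightedGegenbauerDeriv, harmonicGegenbauer, ← hνdef,
        Real.sin_pi_div_two, Real.cos_pi_div_two, Real.one_rpow]
      ring
    rw [e] at key
    refine key.trans_eq ?_
    rw [abs_mul, abs_neg, abs_of_nonneg (by positivity)]
  · intro t ht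
    have hs := hsin t ht
    rw [abs_neg, abs_div, abs_mul, abs_mul, abs_div, abs_mul, abs_of_pos hlam, abs_of_pos hν,
      abs_of_pos (pow_pos hs 2)]
    calc lam * |1 - lam| / Real.sin t ^ 2 * |weightedGegenbauer lam n t|
          * |Real.sin (ν * (θ - t))| / ν
        ≤ lam * |1 - lam| / Real.sin t ^ 2 * M * 1 / ν := by
          gcongr
          · exact hM t ht
          · exact Real.abs_sin_le_one _
      _ = _ := by field_simp

theorem abs_harmonicGegenbauer_le_amplitude {lam : ℝ} (hlam : 0 < lam) (n : ℕ) (t : ℝ) :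
    |harmonicGegenbauer lam n t| ≤ gegenbauerAmplitude lam n := by
  have hν : (0 : ℝ) < n + lam := by positivity
  rw [harmonicGegenbauer, gegenbauerAmplitude]
  refine (abs_add_le _ _).trans ?_
  rw [abs_mul, abs_mul, abs_div, abs_mul, abs_of_pos hν, abs_of_pos (by positivity : (0:ℝ) < n + 1)]
  gcongr
  · exact mul_le_of_le_one_right (abs_nonneg _) (Real.abs_cos_le_one _)
  · exact mul_le_of_le_one_right (by positivity) (Real.abs_sin_le_one _)

theorem abs_cot_le_of_mem_uIcc {θ t : ℝ} (hθ : θ ∈ Set.Ioo 0 Real.pi)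
    (ht : t ∈ Set.uIcc (Real.pi / 2) θ) :
    |Real.cos t / Real.sin t| ≤ |Real.cos θ / Real.sin θ| := by
  have hst := sin_pos_of_mem_uIcc hθ ht
  have hsθ := Real.sin_pos_of_mem_Ioo hθ
  have hπ := Real.pi_pos
  have hc : |Real.cos t| ≤ |Real.cos θ| := by
    rcases le_total (Real.pi / 2) θ with h | h
    · rw [Set.uIcc_of_le h] at ht
      have h1 : Real.cos θ ≤ Real.cos t :=
        Real.cos_le_cos_of_nonneg_of_le_pi (by linarith [ht.1]) hθ.2.le ht.2
      have h2 : Real.cos t ≤ 0 :=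
        Real.cos_nonpos_of_pi_div_two_le_of_le ht.1 (by linarith [ht.2, hθ.2])
      rw [abs_of_nonpos h2, abs_of_nonpos (h1.trans h2)]
      linarith
    · rw [Set.uIcc_of_ge h] at ht
      have h1 : Real.cos t ≤ Real.cos θ :=
        Real.cos_le_cos_of_nonneg_of_le_pi hθ.1.le (by linarith [ht.2]) ht.1
      have h2 : 0 ≤ Real.cos t :=
        Real.cos_nonneg_of_mem_Icc ⟨by linarith [ht.1, hθ.1], ht.2⟩
      rw [abs_of_nonneg h2, abs_of_nonneg (h2.trans h1)]
      exact h1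
  have hs : Real.sin θ ≤ Real.sin t := by
    have := sq_le_sq.2 hc
    refine le_of_sq_le_sq ?_ hst.le
    nlinarith [Real.sin_sq_add_cos_sq t, Real.sin_sq_add_cos_sq θ]
  rw [abs_div, abs_div, abs_of_pos hst, abs_of_pos hsθ]
  gcongr

/-- Bootstrap: the estimate at a point where `|u|` attains its maximum `M` gives `M ≤ κ M + A`,
hence `M ≤ A / (1 - κ)`, which is fed back into the estimate at `θ`. -/
theorem abs_weightedGegenbauer_sub_le_amplitude {lam : ℝ} (hlam : 0 < lam) (n : ℕ) {θ κ : ℝ}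
    (hθ : θ ∈ Set.Ioo 0 Real.pi) (hκ1 : κ < 1)
    (hκ : lam * |1 - lam| * |Real.cos θ / Real.sin θ| ≤ κ * (n + lam)) :
    |weightedGegenbauer lam n θ - harmonicGegenbauer lam n θ|
      ≤ κ / (1 - κ) * gegenbauerAmplitude lam n := by
  have hν : (0 : ℝ) < n + lam := by positivity
  have hcont : ContinuousOn (fun t => |weightedGegenbauer lam n t|) (Set.uIcc (Real.pi / 2) θ) :=
    fun t ht => (hasDerivAt_weightedGegenbauer lam n
      (sin_pos_of_mem_uIcc hθ ht)).continuousAt.abs.continuousWithinAt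
  obtain ⟨t, ht, hmax⟩ := isCompact_uIcc.exists_isMaxOn ⟨θ, Set.right_mem_uIcc⟩ hcont
  set M := |weightedGegenbauer lam n t| with hMdef
  have hM : ∀ s ∈ Set.uIcc (Real.pi / 2) θ, |weightedGegenbauer lam n s| ≤ M := hmax
  have hM0 : 0 ≤ M := abs_nonneg _
  have hκ' : lam * |1 - lam| / (n + lam) * |Real.cos θ / Real.sin θ| ≤ κ := by
    rw [div_mul_eq_mul_div, div_le_iff₀ hν]
    exact hκ
  have hfac : lam * |1 - lam| / (n + lam) * M * |Real.cos θ / Real.sin θ| ≤ κ * M := by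
    calc _ = lam * |1 - lam| / (n + lam) * |Real.cos θ / Real.sin θ| * M := by ring
      _ ≤ _ := by gcongr
  have htπ : t ∈ Set.Ioo 0 Real.pi := by
    have hπ := Real.pi_pos
    exact Set.ordConnected_Ioo.uIcc_subset ⟨by linarith, by linarith⟩ hθ ht
  have h1 := abs_weightedGegenbauer_sub_le hlam n htπ
    fun s hs => hM s (Set.uIcc_subset_uIcc_left ht hs)
  have h2 : |weightedGegenbauer lam n t - harmonicGegenbauer lam n t| ≤ κ * M := by
    refine (h1.trans ?_).trans hfac
    exact mul_le_mul_of_nonneg_left (abs_cot_le_of_mem_uIcc hθ ht) (by positivity)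
  have h3 : M ≤ κ * M + gegenbauerAmplitude lam n := by
    have := abs_sub_abs_le_abs_sub (weightedGegenbauer lam n t) (harmonicGegenbauer lam n t)
    linarith [abs_harmonicGegenbauer_le_amplitude hlam n t]
  have hκ0 : 0 ≤ κ := le_trans (by positivity) hκ'
  refine ((abs_weightedGegenbauer_sub_le hlam n hθ hM).trans hfac).trans ?_
  rw [div_mul_eq_mul_div, le_div_iff₀ (by linarith)]
  nlinarith

/-! ### Values at `0` and growth of the amplitude. -/

theorem gegenbauer_add_two_at_zero (lam : ℝ) (n : ℕ) :
    ((n : ℝ) + 2) * gegenbauer lam (n + 2) 0 = -((n + 2 * lam) * gegenbauer lam n 0) := by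
  rw [gegenbauer_add_two]
  ring

theorem gegenbauer_odd_at_zero (lam : ℝ) (m : ℕ) : gegenbauer lam (2 * m + 1) 0 = 0 := by
  induction m with
  | zero => simp [gegenbauer_one]
  | succ m ih =>
    have h := gegenbauer_add_two_at_zero lam (2 * m + 1)
    rw [ih, mul_zero, neg_zero] at h
    exact (mul_eq_zero.1 h).resolve_left (by positivity)

/-- The factor `lam + m` on both sides makes the product the denominator of `Real.GammaSeq`. -/
theorem abs_gegenbauer_even_at_zero {lam : ℝ} (hlam : 0 < lam) (m : ℕ) :
    |gegenbauer lam (2 * m) 0| * (m.factorial * (lam + m))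
      = ∏ j ∈ Finset.range (m + 1), (lam + j) := by
  induction m with
  | zero => simp [gegenbauer_zero]
  | succ m ih =>
    rw [Finset.prod_range_succ, ← ih]
    have h := congrArg abs (gegenbauer_add_two_at_zero lam (2 * m))
    rw [abs_neg, abs_mul, abs_mul, abs_of_pos (by positivity : (0 : ℝ) < (2 * m : ℕ) + 2),
      abs_of_pos (by positivity : (0 : ℝ) < (2 * m : ℕ) + 2 * lam)] at h
    push_cast at h
    rw [Nat.factorial_succ, show 2 * (m + 1) = 2 * m + 2 by ring]
    push_cast
    linear_combination (m.factorial * (lam + m + 1) / 2) * h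

theorem abs_gegenbauer_even_at_zero_pos {lam : ℝ} (hlam : 0 < lam) (m : ℕ) :
    0 < |gegenbauer lam (2 * m) 0| := by
  have h := abs_gegenbauer_even_at_zero hlam m
  have hp : 0 < ∏ j ∈ Finset.range (m + 1), (lam + j) :=
    Finset.prod_pos fun j _ => by positivity
  rw [← h] at hp
  exact pos_of_mul_pos_left hp (by positivity)

theorem gegenbauerAmplitude_even (lam : ℝ) (m : ℕ) :
    gegenbauerAmplitude lam (2 * m) = |gegenbauer lam (2 * m) 0| := by
  simp [gegenbauerAmplitude, gegenbauer_odd_at_zero]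

theorem gegenbauerAmplitude_odd (lam : ℝ) (m : ℕ) :
    gegenbauerAmplitude lam (2 * m + 1)
      = (2 * (m + 1)) * |gegenbauer lam (2 * (m + 1)) 0| / (2 * m + 1 + lam) := by
  rw [gegenbauerAmplitude, gegenbauer_odd_at_zero]
  push_cast
  rw [show 2 * m + 1 + 1 = 2 * (m + 1) by ring]
  simp only [abs_zero, zero_add]
  ring

theorem gegenbauerAmplitude_pos {lam : ℝ} (hlam : 0 < lam) (n : ℕ) :
    0 < gegenbauerAmplitude lam n := by
  rcases n.even_or_odd' with ⟨m, rfl | rfl⟩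
  · rw [gegenbauerAmplitude_even]
    exact abs_gegenbauer_even_at_zero_pos hlam m
  · rw [gegenbauerAmplitude_odd]
    have := abs_gegenbauer_even_at_zero_pos hlam (m + 1)
    positivity

/-- By parity one of the two terms vanishes; recentring the phase from `π / 2` costs a sign, and for
odd `n` a quarter turn that changes the sine into a cosine. -/
theorem abs_harmonicGegenbauer {lam : ℝ} (hlam : 0 < lam) (n : ℕ) (θ : ℝ) :
    |harmonicGegenbauer lam n θ|
      = gegenbauerAmplitude lam n * |Real.cos ((n + lam) * θ - lam * Real.pi / 2)| := by
  rcases n.even_or_odd' with ⟨m, rfl | rfl⟩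
  · rw [gegenbauerAmplitude_even, harmonicGegenbauer, gegenbauer_odd_at_zero]
    push_cast
    rw [show (2 * (m : ℝ) + lam) * (θ - Real.pi / 2)
      = ((2 * m + lam) * θ - lam * Real.pi / 2) - m * Real.pi by ring, Real.cos_sub_nat_mul_pi]
    simp [abs_mul]
  · rw [gegenbauerAmplitude_odd, harmonicGegenbauer, gegenbauer_odd_at_zero]
    push_cast
    rw [show (2 * (m : ℝ) + 1 + lam) * (θ - Real.pi / 2)
      = (((2 * m + 1 + lam) * θ - lam * Real.pi / 2) - Real.pi / 2) - m * Real.pi by ring,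
      Real.sin_sub_nat_mul_pi, Real.sin_sub_pi_div_two,
      show 2 * m + 1 + 1 = 2 * (m + 1) by ring, zero_mul, zero_add, abs_mul, abs_mul, abs_div,
      abs_mul, abs_of_pos (by positivity : (0 : ℝ) < 2 * m + 1 + lam),
      abs_of_pos (by positivity : (0 : ℝ) < 2 * m + 1 + 1)]
    simp only [abs_neg, abs_pow, abs_one, one_pow, one_mul]
    ring

theorem tendsto_gegenbauer_even_at_zero {lam : ℝ} (hlam : 0 < lam) :
    Filter.Tendsto (fun m : ℕ => |gegenbauer lam (2 * m) 0| / (m : ℝ) ^ (lam - 1))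
      Filter.atTop (nhds (Real.Gamma lam)⁻¹) := by
  have h1 := (Real.GammaSeq_tendsto_Gamma lam).inv₀ (Real.Gamma_pos_of_pos hlam).ne'
  have h2 : Filter.Tendsto (fun m : ℕ => (m : ℝ) / (m + lam)) Filter.atTop (nhds 1) :=
    tendsto_natCast_div_add_atTop lam
  have h3 := h1.mul h2
  rw [mul_one] at h3
  refine h3.congr' ?_
  filter_upwards [Filter.eventually_gt_atTop 0] with m hm
  have hm' : (0 : ℝ) < m := by exact_mod_cast hm
  rw [Real.GammaSeq, ← abs_gegenbauer_even_at_zero hlam m, Real.rpow_sub_one hm'.ne']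
  have := Real.rpow_pos_of_pos hm' lam
  have : (m.factorial : ℝ) ≠ 0 := by positivity
  field_simp
  ring

theorem tendsto_gegenbauerAmplitude_div_rpow {lam : ℝ} (hlam : 0 < lam) :
    Filter.Tendsto (fun n : ℕ => gegenbauerAmplitude lam n / (n : ℝ) ^ (lam - 1))
      Filter.atTop (nhds ((Real.Gamma lam)⁻¹ * (1 / 2) ^ (lam - 1))) := by
  have hr := tendsto_gegenbauer_even_at_zero hlam
  have he : Filter.Tendsto (fun m : ℕ => gegenbauerAmplitude lam (2 * m)
      / ((2 * m : ℕ) : ℝ) ^ (lam - 1)) Filter.atTop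
      (nhds ((Real.Gamma lam)⁻¹ * (1 / 2) ^ (lam - 1))) := by
    refine (hr.mul_const ((1 / 2 : ℝ) ^ (lam - 1))).congr fun m => ?_
    rw [gegenbauerAmplitude_even, Nat.cast_mul, Real.mul_rpow (by positivity) (by positivity),
      one_div, Real.inv_rpow (by positivity), Nat.cast_two]
    field_simp
  have ho : Filter.Tendsto (fun m : ℕ => gegenbauerAmplitude lam (2 * m + 1)
      / ((2 * m + 1 : ℕ) : ℝ) ^ (lam - 1)) Filter.atTop
      (nhds ((Real.Gamma lam)⁻¹ * (1 / 2) ^ (lam - 1))) := by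
    -- This is the factor `2 (m + 1) / (2 m + 1 + lam)` of the odd amplitude; the next limit
    -- converts powers of `m + 1` into powers of `2 m + 1`.
    have h1 : Filter.Tendsto (fun m : ℕ => (((m + 1 : ℕ) : ℝ) / ((m + 1 : ℕ) + (lam - 1) / 2)))
        Filter.atTop (nhds 1) :=
      (tendsto_natCast_div_add_atTop ((lam - 1) / 2)).comp (Filter.tendsto_add_atTop_nat 1)
    have h2 : Filter.Tendsto (fun m : ℕ => (((m + 1 : ℕ) : ℝ) / ((m + 1 : ℕ) + (-1 / 2 : ℝ))))
        Filter.atTop (nhds 1) :=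
      (tendsto_natCast_div_add_atTop (-1 / 2 : ℝ)).comp (Filter.tendsto_add_atTop_nat 1)
    have h3 := (h2.mul_const (1 / 2)).rpow_const (p := lam - 1) (Or.inl (by norm_num))
    have h4 := ((hr.comp (Filter.tendsto_add_atTop_nat 1)).mul h1).mul h3
    rw [mul_one, one_mul] at h4
    refine h4.congr fun m => ?_
    have hm : ((m + 1 : ℕ) : ℝ) / ((m + 1 : ℕ) + (-1 / 2 : ℝ)) * (1 / 2)
        = ((m + 1 : ℕ) : ℝ) / ((2 * m + 1 : ℕ) : ℝ) := by
      push_cast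
      rw [show (m : ℝ) + 1 + -1 / 2 = (2 * m + 1) / 2 by ring]
      field_simp
    rw [hm, gegenbauerAmplitude_odd, Real.div_rpow (by positivity) (by positivity)]
    simp only [Function.comp_apply]
    push_cast
    rw [show (m : ℝ) + 1 + (lam - 1) / 2 = (2 * m + 1 + lam) / 2 by ring]
    have : (0 : ℝ) < 2 * m + 1 + lam := by positivity
    field_simp
  rw [Filter.tendsto_def] at he ho ⊢
  intro s hs
  obtain ⟨a, ha⟩ := Filter.mem_atTop_sets.1 (he s hs)
  obtain ⟨b, hb⟩ := Filter.mem_atTop_sets.1 (ho s hs)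
  refine Filter.mem_atTop_sets.2 ⟨2 * a + 2 * b, fun n hn => ?_⟩
  rcases n.even_or_odd' with ⟨m, rfl | rfl⟩
  · exact ha m (by lia)
  · exact hb m (by lia)

theorem eventually_gegenbauerAmplitude_bounds {lam : ℝ} (hlam : 0 < lam) :
    ∃ c C : ℝ, 0 < c ∧ 0 < C ∧ ∀ᶠ n : ℕ in Filter.atTop,
      c * (n : ℝ) ^ (lam - 1) ≤ gegenbauerAmplitude lam n ∧
        gegenbauerAmplitude lam n ≤ C * (n : ℝ) ^ (lam - 1) := by
  have ht := tendsto_gegenbauerAmplitude_div_rpow hlam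
  have hL : 0 < (Real.Gamma lam)⁻¹ * (1 / 2) ^ (lam - 1) :=
    mul_pos (inv_pos.2 (Real.Gamma_pos_of_pos hlam)) (by positivity)
  set L := (Real.Gamma lam)⁻¹ * (1 / 2) ^ (lam - 1)
  refine ⟨L / 2, 2 * L, by positivity, by positivity, ?_⟩
  filter_upwards [ht.eventually_const_le (by linarith : L / 2 < L),
    ht.eventually_le_const (by linarith : L < 2 * L), Filter.eventually_gt_atTop 0]
    with n h1 h2 hn
  have hn' : (0 : ℝ) < (n : ℝ) ^ (lam - 1) := Real.rpow_pos_of_pos (by exact_mod_cast hn) _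
  exact ⟨(le_div_iff₀ hn').1 h1, (div_le_iff₀ hn').1 h2⟩

/-! ### Density modulo one and distance to the nearest integer. -/

theorem Irrational.exists_nat_abs_mul_add_sub_int_lt {α : ℝ} (hα : Irrational α) (γ : ℝ) {ε : ℝ}
    (hε : 0 < ε) (n₀ : ℕ) : ∃ n : ℕ, n₀ ≤ n ∧ ∃ m : ℤ, |n * α + γ - m| < ε := by
  have hd : DenseRange (fun k : ℕ => k • (α : AddCircle (1 : ℝ))) := by
    rw [← denseRange_zsmul_iff_nsmul, AddCircle.denseRange_zsmul_coe_iff]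
    simpa using hα
  obtain ⟨k, hk⟩ := hd.exists_dist_lt ((-γ - n₀ * α : ℝ) : AddCircle (1 : ℝ)) hε
  refine ⟨n₀ + k, by lia, round ((n₀ + k : ℕ) * α + γ), ?_⟩
  rw [dist_comm, dist_eq_norm, ← AddCircle.coe_nsmul, ← AddCircle.coe_sub, UnitAddCircle.norm_eq]
    at hk
  have e : k • α - (-γ - n₀ * α) = (n₀ + k : ℕ) * α + γ := by
    rw [nsmul_eq_mul]; push_cast; ring
  rwa [e] at hk

theorem distNearestInt_add_int (y : ℝ) (m : ℤ) : distNearestInt (y + m) = distNearestInt y := by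
  rw [distNearestInt, distNearestInt, round_add_intCast]
  push_cast
  congr 1
  ring

theorem distNearestInt_le_half (y : ℝ) : distNearestInt y ≤ 1 / 2 := abs_sub_round y

theorem two_mul_distNearestInt_le_abs_sin (y : ℝ) :
    2 * distNearestInt y ≤ |Real.sin (Real.pi * y)| := by
  have h := abs_sub_round y
  have hπ := Real.pi_pos
  have e : |Real.sin (Real.pi * y)| = |Real.sin (Real.pi * (y - round y))| := by
    rw [show Real.pi * (y - round y) = Real.pi * y - round y * Real.pi by ring,
      Real.sin_sub_int_mul_pi]
    simp [abs_mul]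
  rw [e, distNearestInt]
  have := Real.mul_abs_le_abs_sin (x := Real.pi * (y - round y)) (by
    rw [abs_mul, abs_of_pos hπ]; nlinarith)
  rw [abs_mul, abs_of_pos hπ] at this
  refine le_trans (le_of_eq ?_) this
  field_simp

theorem abs_cos_le_pi_mul_abs (z : ℝ) (m : ℤ) :
    |Real.cos (Real.pi * z)| ≤ Real.pi * |z - 1 / 2 - m| := by
  have e : |Real.cos (Real.pi * z)| = |Real.sin (Real.pi * (z - 1 / 2 - m))| := by
    rw [show Real.pi * (z - 1 / 2 - m) = (Real.pi * z - Real.pi / 2) - m * Real.pi by ring,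
      Real.sin_sub_int_mul_pi, Real.sin_sub_pi_div_two]
    simp [abs_mul]
  rw [e]
  refine Real.abs_sin_le_abs.trans_eq ?_
  rw [abs_mul, abs_of_pos Real.pi_pos]

theorem Finset.exists_pos_forall_le {ι : Type*} (s : Finset ι) (f : ι → ℝ)
    (hf : ∀ i ∈ s, 0 < f i) : ∃ d, 0 < d ∧ ∀ i ∈ s, d ≤ f i := by
  rcases s.eq_empty_or_nonempty with rfl | hs
  · exact ⟨1, one_pos, by simp⟩
  · obtain ⟨i, hi, hmin⟩ := s.exists_min_image f hs
    exact ⟨f i, hf i hi, hmin⟩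

/-! ### From bad approximability to a rational angle. -/

theorem isGegenbadlyApproximable_of_eventually {lam x c : ℝ} (hx : x ∈ Set.Ioo (-1 : ℝ) 1)
    (hne : ∀ n : ℕ, gegenbauer lam n x ≠ 0) (hc : 0 < c)
    (h : ∀ᶠ n : ℕ in Filter.atTop, c * (n : ℝ) ^ (lam - 1) ≤ |gegenbauer lam n x|) :
    IsGegenbadlyApproximable lam x := by
  obtain ⟨n₀, hn₀⟩ := Filter.eventually_atTop.1 h
  have hpow : ∀ n : ℕ, 1 ≤ n → 0 < (n : ℝ) ^ (lam - 1) := fun n hn =>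
    Real.rpow_pos_of_pos (by exact_mod_cast hn) _
  obtain ⟨d, hd, hdle⟩ := (Finset.Icc 1 n₀).exists_pos_forall_le
    (fun n => |gegenbauer lam n x| / (n : ℝ) ^ (lam - 1))
    fun n hn => div_pos (abs_pos.2 (hne n)) (hpow n (Finset.mem_Icc.1 hn).1)
  refine ⟨hx, min c d, lt_min hc hd, fun n hn => ?_⟩
  have hp := hpow n hn
  rcases le_total n₀ n with hle | hle
  · refine le_trans ?_ (hn₀ n hle)
    gcongr
    exact min_le_left c d
  · rw [← le_div_iff₀ hp]
    exact (min_le_right c d).trans (hdle n (Finset.mem_Icc.2 ⟨hn, hle⟩))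

theorem IsGegenbadlyApproximable.eventually_le_abs_cos {lam α : ℝ} (hlam : 0 < lam)
    (hα : α ∈ Set.Ioo (0 : ℝ) 1)
    (h : IsGegenbadlyApproximable lam (Real.cos (Real.pi * α))) :
    ∃ η : ℝ, 0 < η ∧ ∀ᶠ n : ℕ in Filter.atTop,
      η ≤ |Real.cos (Real.pi * ((n + lam) * α - lam / 2))| := by
  obtain ⟨-, c, hc, hbad⟩ := h
  obtain ⟨_, C, _, hC, hamp⟩ := eventually_gegenbauerAmplitude_bounds hlam
  have hθ : Real.pi * α ∈ Set.Ioo 0 Real.pi :=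
    ⟨mul_pos Real.pi_pos hα.1, mul_lt_of_lt_one_right Real.pi_pos hα.2⟩
  have hs := Real.rpow_pos_of_pos (Real.sin_pos_of_mem_Ioo hθ) lam
  set s := Real.sin (Real.pi * α) ^ lam with hsdef
  -- Chosen so that `|u| ≥ 2 η A_n`; taking `κ = η / (1 + η)` makes the error at most `η A_n`, which
  -- leaves `η A_n` for the oscillator.
  set η := s * c / (2 * C) with hη
  have hη0 : 0 < η := by positivity
  have hlim : Filter.Tendsto (fun n : ℕ => η / (1 + η) * ((n : ℝ) + lam)) Filter.atTop
      Filter.atTop :=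
    (Filter.tendsto_atTop_add_const_right _ _ tendsto_natCast_atTop_atTop).const_mul_atTop
      (by positivity)
  refine ⟨η, hη0, ?_⟩
  filter_upwards [hamp, Filter.eventually_ge_atTop 1, hlim.eventually_ge_atTop
    (lam * |1 - lam| * |Real.cos (Real.pi * α) / Real.sin (Real.pi * α)|)] with n hn hn1 hκ
  have hA := gegenbauerAmplitude_pos hlam n
  have h1 := abs_weightedGegenbauer_sub_le_amplitude hlam n hθ
    ((div_lt_one (by positivity)).2 (by linarith)) hκ
  have hκ' : η / (1 + η) / (1 - η / (1 + η)) = η := by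
    field_simp
    ring
  rw [hκ'] at h1
  have h2 : 2 * η * gegenbauerAmplitude lam n ≤ |weightedGegenbauer lam n (Real.pi * α)| := by
    rw [weightedGegenbauer, abs_mul, ← hsdef, abs_of_pos hs]
    calc 2 * η * gegenbauerAmplitude lam n ≤ 2 * η * (C * (n : ℝ) ^ (lam - 1)) := by
          gcongr
          exact hn.2
      _ = s * (c * (n : ℝ) ^ (lam - 1)) := by
          rw [hη]
          field_simp
      _ ≤ _ := by
          gcongr
          exact hbad n hn1
  have h3 := abs_sub_abs_le_abs_sub (weightedGegenbauer lam n (Real.pi * α))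
    (harmonicGegenbauer lam n (Real.pi * α))
  rw [abs_harmonicGegenbauer hlam] at h3
  rw [show Real.pi * ((n + lam) * α - lam / 2)
    = (n + lam) * (Real.pi * α) - lam * Real.pi / 2 by ring]
  refine le_of_mul_le_mul_left ?_ hA
  linarith

theorem IsGegenbadlyApproximable.not_irrational {lam α : ℝ} (hlam : 0 < lam)
    (hα : α ∈ Set.Ioo (0 : ℝ) 1)
    (h : IsGegenbadlyApproximable lam (Real.cos (Real.pi * α))) : ¬ Irrational α := by
  intro hirr
  obtain ⟨η, hη, hev⟩ := h.eventually_le_abs_cos hlam hα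
  obtain ⟨n₀, hn₀⟩ := Filter.eventually_atTop.1 hev
  obtain ⟨n, hn, m, hm⟩ := hirr.exists_nat_abs_mul_add_sub_int_lt (lam * α - lam / 2 - 1 / 2)
    (div_pos hη Real.pi_pos) n₀
  have h1 := (hn₀ n hn).trans (abs_cos_le_pi_mul_abs ((n + lam) * α - lam / 2) m)
  rw [lt_div_iff₀ Real.pi_pos, mul_comm, show (n : ℝ) * α + (lam * α - lam / 2 - 1 / 2) - m
    = (n + lam) * α - lam / 2 - 1 / 2 - m by ring] at hm
  linarith

theorem IsGegenbadlyApproximable.nonDivisibilityCondition {lam : ℝ} (hlam : 0 < lam) {p q : ℕ}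
    (hp : 0 < p) (hpq : p < q)
    (h : IsGegenbadlyApproximable lam (Real.cos (Real.pi * ((p : ℝ) / q)))) :
    NonDivisibilityCondition lam p q := by
  rintro n - - ⟨m, hm⟩
  have hq : (0 : ℝ) < q := by exact_mod_cast hp.trans hpq
  obtain ⟨η, hη, hev⟩ := h.eventually_le_abs_cos hlam
    ⟨by positivity, (div_lt_one hq).2 (by exact_mod_cast hpq)⟩
  obtain ⟨n₀, hn₀⟩ := Filter.eventually_atTop.1 hev
  -- Adding a multiple of `q` keeps the cosine zero while making the index large.
  have hle : n₀ ≤ n + n₀ * q := le_add_left (Nat.le_mul_of_pos_right _ (hp.trans hpq))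
  have h1 := (hn₀ _ hle).trans (abs_cos_le_pi_mul_abs _ (m + n₀ * p))
  have h0 : (((n + n₀ * q : ℕ) : ℝ) + lam) * ((p : ℝ) / q) - lam / 2 - 1 / 2
      - ((m + n₀ * p : ℤ) : ℝ) = 0 := by
    push_cast at hm ⊢
    field_simp
    linear_combination hm
  rw [h0, abs_zero, mul_zero] at h1
  linarith

theorem IsGegenbadlyApproximable.exists_rational_angle {lam x : ℝ} (hlam : 0 < lam)
    (h : IsGegenbadlyApproximable lam x) :
    ∃ p q : ℕ, IsCosOfRationalAngle x p q ∧ NonDivisibilityCondition lam p q := by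
  obtain ⟨hx1, hx2⟩ := h.1
  have hcos : x = Real.cos (Real.pi * (Real.arccos x / Real.pi)) := by
    rw [mul_div_cancel₀ _ Real.pi_ne_zero, Real.cos_arccos hx1.le hx2.le]
  have hα : Real.arccos x / Real.pi ∈ Set.Ioo (0 : ℝ) 1 :=
    ⟨div_pos (Real.arccos_pos.2 hx2) Real.pi_pos,
      (div_lt_one Real.pi_pos).2 (Real.arccos_lt_pi.2 hx1)⟩
  have hrat : ¬ Irrational (Real.arccos x / Real.pi) := by
    rw [hcos] at h
    exact h.not_irrational hlam hα
  obtain ⟨r, hr⟩ := not_not.1 hrat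
  rw [← hr] at hα hcos
  have hr0 : 0 < r := by exact_mod_cast hα.1
  have hr1 : r < 1 := by exact_mod_cast hα.2
  obtain ⟨p, hp⟩ := Int.eq_ofNat_of_zero_le (Rat.num_nonneg.2 hr0.le)
  have hrpq : (r : ℝ) = (p : ℝ) / (r.den : ℝ) := by
    rw [Rat.cast_def, hp]
    simp
  have hp0 : 0 < p := by
    have := Rat.num_pos.2 hr0
    lia
  have hpq : p < r.den := by
    have h1 := hα.2
    rw [hrpq, div_lt_one (by exact_mod_cast r.den_pos)] at h1
    exact_mod_cast h1
  rw [hrpq] at hcos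
  refine ⟨p, r.den, ⟨hp0, hpq, hcos⟩, ?_⟩
  rw [hcos] at h
  exact h.nonDivisibilityCondition hlam hp0 hpq

/-! ### From a rational angle to explicit lower bounds. -/

theorem minPhaseDist_pos {lam : ℝ} {p q : ℕ} (hq : 1 ≤ q)
    (h : NonDivisibilityCondition lam p q) : 0 < minPhaseDist lam p q := by
  obtain ⟨n, ⟨hn1, hnq⟩, hn⟩ := (minPhaseDist_isLeast lam p q hq).1
  have hq' : (q : ℝ) ≠ 0 := by positivity
  rw [← hn]
  refine abs_pos.2 fun h0 => h n hn1 hnq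
    ⟨round (((n : ℝ) + lam) * ((p : ℝ) / q) - (lam + 1) / 2), ?_⟩
  rw [← sub_eq_zero.1 h0]
  push_cast
  field_simp
  ring

theorem minPhaseDist_le {lam : ℝ} {p q : ℕ} (hq : 1 ≤ q) {n : ℕ} (hn : 1 ≤ n) :
    minPhaseDist lam p q
      ≤ distNearestInt (((n : ℝ) + lam) * ((p : ℝ) / q) - (lam + 1) / 2) := by
  -- Dividing `n - 1` rather than `n` yields representatives in `1, ..., q`.
  have hmod := Nat.mod_add_div (n - 1) q
  have hlt := Nat.mod_lt (n - 1) hq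
  set r := (n - 1) % q
  set k := (n - 1) / q
  have hnr : n = (r + 1) + q * k := by lia
  have hq' : (q : ℝ) ≠ 0 := by positivity
  have e : ((n : ℝ) + lam) * ((p : ℝ) / q) - (lam + 1) / 2
      = ((((r + 1 : ℕ) : ℝ) + lam) * ((p : ℝ) / q) - (lam + 1) / 2) + ((p * k : ℤ) : ℝ) := by
    rw [hnr]
    push_cast
    field_simp
    ring
  rw [e, distNearestInt_add_int]
  exact (minPhaseDist_isLeast lam p q hq).2 ⟨r + 1, ⟨by lia, by lia⟩, rfl⟩

/-- With `δ` the minimal phase distance, the oscillator is at least `2 δ A_n`. The threshold on `n`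
allows `κ = 2 δ / π`; since `δ ≤ 1 / 2` and `π > 3`, the error `κ / (1 - κ)` is at most `δ`. -/
theorem minPhaseDist_mul_amplitude_le {lam : ℝ} (hlam : 0 < lam) {p q : ℕ} (hp : 0 < p)
    (hpq : p < q) (h : NonDivisibilityCondition lam p q) {n : ℕ}
    (hn : Real.pi / 2 * (lam * |1 - lam| * |Real.cot (Real.pi * ((p : ℝ) / q))|
      / minPhaseDist lam p q) < n) :
    minPhaseDist lam p q * gegenbauerAmplitude lam n
      ≤ |gegenbauer lam n (Real.cos (Real.pi * ((p : ℝ) / q)))| := by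
  have hq : (0 : ℝ) < q := by exact_mod_cast hp.trans hpq
  have hπ := Real.pi_gt_three
  have hθ : Real.pi * ((p : ℝ) / q) ∈ Set.Ioo 0 Real.pi :=
    ⟨by positivity, mul_lt_of_lt_one_right Real.pi_pos ((div_lt_one hq).2 (by exact_mod_cast hpq))⟩
  have hq1 : 1 ≤ q := by lia
  have hδ := minPhaseDist_pos hq1 h
  have hn0 : (0 : ℝ) < n := lt_of_le_of_lt (by positivity) hn
  have hδn := minPhaseDist_le (lam := lam) (p := p) hq1 (n := n) (by exact_mod_cast hn0)
  have hδ2 := hδn.trans (distNearestInt_le_half _)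
  have hsin := two_mul_distNearestInt_le_abs_sin
    (((n : ℝ) + lam) * ((p : ℝ) / q) - (lam + 1) / 2)
  rw [show Real.pi * (((n : ℝ) + lam) * ((p : ℝ) / q) - (lam + 1) / 2)
    = ((n + lam) * (Real.pi * ((p : ℝ) / q)) - lam * Real.pi / 2) - Real.pi / 2 by ring,
    Real.sin_sub_pi_div_two, abs_neg] at hsin
  set δ := minPhaseDist lam p q
  set θ := Real.pi * ((p : ℝ) / q)
  have hA := gegenbauerAmplitude_pos hlam n
  have hκ3 : 2 * δ / Real.pi ≤ 1 / 3 := by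
    rw [div_le_iff₀ Real.pi_pos]
    linarith
  have h1 := abs_weightedGegenbauer_sub_le_amplitude hlam n hθ (κ := 2 * δ / Real.pi)
    (by linarith) (by
      rw [← Real.cot_eq_cos_div_sin]
      rw [← mul_div_assoc, div_lt_iff₀ hδ] at hn
      rw [div_mul_eq_mul_div, le_div_iff₀ Real.pi_pos]
      nlinarith)
  have hκδ : 2 * δ / Real.pi / (1 - 2 * δ / Real.pi) ≤ δ := by
    have h3 : 2 * δ / Real.pi ≤ 2 * δ / 3 := by gcongr
    rw [div_le_iff₀ (by linarith)]
    nlinarith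
  have h2 := abs_sub_abs_le_abs_sub (harmonicGegenbauer lam n θ) (weightedGegenbauer lam n θ)
  rw [abs_sub_comm, abs_harmonicGegenbauer hlam] at h2
  have h3 : gegenbauerAmplitude lam n * (2 * δ)
      ≤ gegenbauerAmplitude lam n * |Real.cos ((n + lam) * θ - lam * Real.pi / 2)| := by
    gcongr
    linarith
  have h4 := mul_le_mul_of_nonneg_right hκδ hA.le
  have h5 : |weightedGegenbauer lam n θ| ≤ |gegenbauer lam n (Real.cos θ)| := by
    have hs := Real.sin_pos_of_mem_Ioo hθ
    rw [weightedGegenbauer, abs_mul, abs_of_pos (Real.rpow_pos_of_pos hs lam)]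
    exact mul_le_of_le_one_left (abs_nonneg _)
      (Real.rpow_le_one hs.le (Real.sin_le_one θ) hlam.le)
  linarith

theorem theorem2 (lam : ℝ) (hlam : 0 < lam) (hodd : ∀ k : ℤ, Odd k → lam ≠ (k : ℝ))
    (x : ℝ) (hx : x ∈ Set.Ioo (-1 : ℝ) 1) :
    (IsGegenbadlyApproximable lam x →
      ∃ p q : ℕ, IsCosOfRationalAngle x p q ∧ NonDivisibilityCondition lam p q) ∧
    (∀ p q : ℕ, IsCosOfRationalAngle x p q → NonDivisibilityCondition lam p q →
      ∃ N : ℕ,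
        (N : ℝ) ≤ Real.pi / 2 *
          (lam * |1 - lam| * |Real.cot (Real.pi * ((p : ℝ) / (q : ℝ)))| / minPhaseDist lam p q) ∧
        ((∃ n : ℕ, n ≤ N ∧ gegenbauer lam n x = 0) ∨ IsGegenbadlyApproximable lam x)) := by
  refine ⟨fun h => h.exists_rational_angle hlam, ?_⟩
  rintro p q ⟨hp, hpq, rfl⟩ hdiv
  have hδ := minPhaseDist_pos (by lia) hdiv
  set B := Real.pi / 2 *
    (lam * |1 - lam| * |Real.cot (Real.pi * ((p : ℝ) / (q : ℝ)))| / minPhaseDist lam p q) with hB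
  have hB0 : 0 ≤ B := by positivity
  -- Beyond `⌊B⌋₊` the lower bound excludes zeros, so only indices up to it need the hypothesis of
  -- nonvanishing.
  refine ⟨⌊B⌋₊, Nat.floor_le hB0, or_iff_not_imp_left.2 fun hzero => ?_⟩
  push Not at hzero
  have hlow : ∀ n : ℕ, ⌊B⌋₊ < n → minPhaseDist lam p q * gegenbauerAmplitude lam n
      ≤ |gegenbauer lam n (Real.cos (Real.pi * ((p : ℝ) / q)))| := fun n hn =>
    minPhaseDist_mul_amplitude_le hlam hp hpq hdiv (Nat.lt_of_floor_lt hn)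
  obtain ⟨c, _, hc, _, hamp⟩ := eventually_gegenbauerAmplitude_bounds hlam
  refine isGegenbadlyApproximable_of_eventually (c := minPhaseDist lam p q * c) hx
    (fun n => ?_) (by positivity) ?_
  · rcases le_or_gt n ⌊B⌋₊ with hn | hn
    · exact hzero n hn
    · exact abs_pos.1 ((mul_pos hδ (gegenbauerAmplitude_pos hlam n)).trans_le (hlow n hn))
  · filter_upwards [hamp, Filter.eventually_gt_atTop ⌊B⌋₊] with n h1 h2
    refine le_trans ?_ (hlow n h2)
    rw [mul_assoc]
    gcongr
    exact h1.1
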